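/- **Setting.** Let $d\in\{2,3\}$, let $\Omega\subset\mathbb R^d$ be a bounded open set, $\|\cdot\|$ and $(\cdot,\cdot)$ the $L^2(\Omega)$ norm and inner product, $X=H^1_0(\Omega)^d$ (the closure in $H^1(\Omega)^d$ of the smooth fields with compact support in $\Omega$), $Q=\{q\in L^2(\Omega):(q,1)=0\}$, and let $X^{-1}$ be the dual of $X$ with norm $\|g\|_{-1}=\sup_{0\ne v\in X}(g,v)/\|\nabla v\|$. Put $$b(u,v,w)=\tfrac12\big((u\cdot\nabla)v,w\big)-\tfrac12\big((u\cdot\nabla)w,v\big).$$ Given a time grid $0=t_0<t_1<\dots<t_N=T$, let $k_n=t_{n+1}-t_n$ for $0\le n\le N-1$ and, for $1\le n\le N-1$, $\varepsilon_n=\frac{k_n-k_{n-1}}{k_n+k_{n-1}}$. For $\theta\in(0,1)$ let $\alpha_2=\frac{\theta+1}2$, $\alpha_1=-\theta$, $\alpha_0=\frac{\theta-1}2$, $\widehat k_n=\alpha_2k_n-\alpha_0k_{n-1}$ and $$\beta_2^{(n)}=\tfrac14\Big(1+\tfrac{1-\theta^2}{(1+\varepsilon_n\theta)^2}+\varepsilon_n^2\tfrac{\theta(1-\theta^2)}{(1+\varepsilon_n\theta)^2}+\theta\Big),\quad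 \beta_1^{(n)}=\tfrac12\Big(1-\tfrac{1-\theta^2}{(1+\varepsilon_n\theta)^2}\Big),\quad \beta_0^{(n)}=\tfrac14\Big(1+\tfrac{1-\theta^2}{(1+\varepsilon_n\theta)^2}-\varepsilon_n^2\tfrac{\theta(1-\theta^2)}{(1+\varepsilon_n\theta)^2}-\theta\Big).$$ For a sequence $(z_n)_{n=0}^N$ write $z_{n,\alpha}=\sum_{\ell=0}^2\alpha_\ell z_{n-1+\ell}$, $z_{n,\beta}=\sum_{\ell=0}^2\beta_\ell^{(n)}z_{n-1+\ell}$ and $$z_{n,*}=\Big(\beta_2^{(n)}\big(1+\tfrac{k_n}{k_{n-1}}\big)+\beta_1^{(n)}\Big)z_n+\Big(\beta_0^{(n)}-\beta_2^{(n)}\tfrac{k_n}{k_{n-1}}\Big)z_{n-1}.$$ Let $h\in(0,1]$, and let $X^h\subset X$, $Q^h\subset Q$ be linear subspaces (e.g. finite element spaces) such that the inverse inequality $\|\nabla v^h\|\le C_{\rm inv}h^{-1}\|v^h\|$ holds for all $v^h\in X^h$. Let $\nu>0$, and for $j=1,\dots,J$ let $f^j$ be a body force with values $f^j(t)\in X^{-1}$;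 put $$\||f^j|\|_{2,-1,\beta}=\Big(\sum_{n=1}^{N-1}(k_n+k_{n-1})\|f^j(t_{n,\beta})\|_{-1}^2\Big)^{1/2}.$$ A *DLN-Ensemble solution* consists of $u_n^{j,h}\in X^h$, $p_n^{j,h}\in Q^h$ ($0\le n\le N$, $1\le j\le J$) such that, with $\langle u^h\rangle_n=\frac1J\sum_{j=1}^Ju_n^{j,h}$, for all $j$, all $1\le n\le N-1$, all $v^h\in X^h$ and all $q^h\in Q^h$, $$\Big(\tfrac{u_{n,\alpha}^{j,h}}{\widehat k_n},v^h\Big)+b\big(\langle u^h\rangle_{n,*},u_{n,\beta}^{j,h},v^h\big)-\big(p_{n,\beta}^{j,h},\nabla\cdot v^h\big)+\nu\big(\nabla u_{n,\beta}^{j,h},\nabla v^h\big)=\big(f^j(t_{n,\beta}),v^h\big)-b\big(u_{n,*}^{j,h}-\langle u^h\rangle_{n,*},u_{n,*}^{j,h},v^h\big),$$ $$\big(\nabla\cdot u_{n,\beta}^{j,h},q^h\big)=0.$$ **Theorem.** There is an absolute constant $C>0$ and, for every $\Omega$, every $C_{\rm inv}>0$ and every $\theta\in(0,1)$, there is a constant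 $C_0=C_0(\Omega,C_{\rm inv},\theta)>0$ such that the following holds for all $h$, $X^h$, $Q^h$, $\nu$, $J$, $T$, $N$, all time grids, all body forces and all DLN-Ensemble solutions as above. If the CFL-like conditions $$1-C_0\Big(\frac{1+\varepsilon_n\theta}{1-\varepsilon_n}\Big)^2\frac{\widehat k_n}{h\nu}\Big\|\nabla\big(u_{n,*}^{j,h}-\langle u^h\rangle_{n,*}\big)\Big\|^2\ge0\qquad(1\le j\le J,\ 1\le n\le N-1)$$ hold, then for all $1\le j\le J$ and all $M=2,3,\dots,N$ $$\frac{1+\theta}4\|u_M^{j,h}\|^2+\frac{1-\theta}4\|u_{M-1}^{j,h}\|^2+\sum_{n=1}^{M-1}\frac{\theta(1-\theta^2)}{4(1+\varepsilon_n\theta)^2}\big\|U_n^{j,h}\big\|^2+\sum_{n=1}^{M-1}\frac{\nu\widehat k_n}4\|\nabla u_{n,\beta}^{j,h}\|^2$$ $$\le\frac C\nu\||f^j|\|_{2,-1,\beta}^2+\frac{1+\theta}4\|u_1^{j,h}\|^2+\frac{1-\theta}4\|u_0^{j,h}\|^2,$$ where $U_n^{j,h}=\frac{1-\varepsilon_n}2u_{n+1}^{j,h}-u_n^{j,h}+\frac{1+\varepsilon_n}2u_{n-1}^{j,h}$.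 -/

import Mathlib

open MeasureTheory
open scoped ContDiff

noncomputable section

namespace DLNEnsemble

/-! ### Function spaces on an open set of `ℝ^d` -/

/-- Euclidean space `ℝ^d`. -/
abbrev E (d : ℕ) : Type := EuclideanSpace ℝ (Fin d)

/-- `d × d` matrices with the Frobenius (Euclidean) norm. -/
abbrev Mat (d : ℕ) : Type := EuclideanSpace ℝ (Fin d × Fin d)

/-- Scalar fields in `L²(Ω)`. -/
abbrev L2Scalar {d : ℕ} (Ω : Set (E d)) : Type := Lp ℝ 2 (volume.restrict Ω)

/-- Vector fields in `L²(Ω)^d`. -/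
abbrev L2Vec {d : ℕ} (Ω : Set (E d)) : Type := Lp (E d) 2 (volume.restrict Ω)

/-- Matrix fields in `L²(Ω)^{d × d}`. -/
abbrev L2Mat {d : ℕ} (Ω : Set (E d)) : Type := Lp (Mat d) 2 (volume.restrict Ω)

/-- `φ` is smooth with compact support contained in `Ω`. -/
def IsTestFunction {d : ℕ} {F : Type} [NormedAddCommGroup F] [NormedSpace ℝ F]
    (Ω : Set (E d)) (φ : E d → F) : Prop :=
  ContDiff ℝ ∞ φ ∧ HasCompactSupport φ ∧ tsupport φ ⊆ Ω

/-- The partial derivative `∂_i φ`. -/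
def partialDeriv {d : ℕ} {F : Type} [NormedAddCommGroup F] [NormedSpace ℝ F]
    (i : Fin d) (φ : E d → F) (x : E d) : F :=
  fderiv ℝ φ x (EuclideanSpace.single i 1)

/-- Pairs (vector field, matrix field) with the norm `(‖u‖² + ‖G‖²)^{1/2}`. -/
abbrev FieldPair {d : ℕ} (Ω : Set (E d)) : Type := WithLp 2 (L2Vec Ω × L2Mat Ω)

theorem integrable_coord_mul_partialDeriv {d : ℕ} {Ω : Set (E d)} (u : L2Vec Ω)
    {φ : E d → ℝ} (hφ : IsTestFunction Ω φ) (i j : Fin d) :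
    Integrable (fun x => u x j * partialDeriv i φ x) (volume.restrict Ω) := by
  have h1 : MemLp (fun x => u x j) 2 (volume.restrict Ω) :=
    (EuclideanSpace.proj (𝕜 := ℝ) j : E d →L[ℝ] ℝ).comp_memLp' (Lp.memLp u)
  have hc : Continuous (partialDeriv i φ) :=
    (hφ.1.continuous_fderiv (by simp)).clm_apply continuous_const
  have hs : HasCompactSupport (partialDeriv i φ) := hφ.2.1.fderiv_apply (𝕜 := ℝ) _
  exact h1.integrable_mul (hc.memLp_of_hasCompactSupport (p := 2) hs)

theorem integrable_coord_mul_test {d : ℕ} {Ω : Set (E d)} (G : L2Mat Ω)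
    {φ : E d → ℝ} (hφ : IsTestFunction Ω φ) (i j : Fin d) :
    Integrable (fun x => G x (i, j) * φ x) (volume.restrict Ω) := by
  have h1 : MemLp (fun x => G x (i, j)) 2 (volume.restrict Ω) :=
    (EuclideanSpace.proj (𝕜 := ℝ) (i, j) : Mat d →L[ℝ] ℝ).comp_memLp'
      (Lp.memLp G)
  exact h1.integrable_mul (hφ.1.continuous.memLp_of_hasCompactSupport (p := 2) hφ.2.1)

/-- The Sobolev space `H¹(Ω)^d`. An element is stored as the pair `(u, ∇u)`, where `u ∈ L²` and the
`L²` matrix field `∇u` with entries `(∇u)_{ij} = ∂_i u_j` is the weak gradient of `u`. -/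
def H1 {d : ℕ} (Ω : Set (E d)) : Submodule ℝ (FieldPair Ω) where
  carrier := {v | ∀ φ : E d → ℝ, IsTestFunction Ω φ → ∀ i j : Fin d,
    ∫ x in Ω, v.fst x j * partialDeriv i φ x = -∫ x in Ω, v.snd x (i, j) * φ x}
  zero_mem' := by
    intro φ _ i j
    have h1 : (fun x => (0 : FieldPair Ω).fst x j * partialDeriv i φ x)
        =ᵐ[volume.restrict Ω] fun _ => 0 := by
      filter_upwards [Lp.coeFn_zero (E d) 2 (volume.restrict Ω)] with x hx
      have : (0 : FieldPair Ω).fst x = 0 := hx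
      rw [this, PiLp.zero_apply, zero_mul]
    have h2 : (fun x => (0 : FieldPair Ω).snd x (i, j) * φ x)
        =ᵐ[volume.restrict Ω] fun _ => 0 := by
      filter_upwards [Lp.coeFn_zero (Mat d) 2 (volume.restrict Ω)] with x hx
      have : (0 : FieldPair Ω).snd x = 0 := hx
      rw [this, PiLp.zero_apply, zero_mul]
    rw [integral_congr_ae h1, integral_congr_ae h2]
    simp
  add_mem' := by
    intro v w hv hw φ hφ i j
    have h1 : (fun x => (v + w).fst x j * partialDeriv i φ x) =ᵐ[volume.restrict Ω]
        fun x => v.fst x j * partialDeriv i φ x + w.fst x j * partialDeriv i φ x := by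
      filter_upwards [Lp.coeFn_add v.fst w.fst] with x hx
      have : (v + w).fst x = v.fst x + w.fst x := hx
      rw [this, PiLp.add_apply]
      ring
    have h2 : (fun x => (v + w).snd x (i, j) * φ x) =ᵐ[volume.restrict Ω]
        fun x => v.snd x (i, j) * φ x + w.snd x (i, j) * φ x := by
      filter_upwards [Lp.coeFn_add v.snd w.snd] with x hx
      have : (v + w).snd x = v.snd x + w.snd x := hx
      rw [this, PiLp.add_apply]
      ring
    rw [integral_congr_ae h1, integral_congr_ae h2,
      integral_add (integrable_coord_mul_partialDeriv _ hφ i j)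
        (integrable_coord_mul_partialDeriv _ hφ i j),
      integral_add (integrable_coord_mul_test _ hφ i j) (integrable_coord_mul_test _ hφ i j),
      hv φ hφ i j, hw φ hφ i j]
    ring
  smul_mem' := by
    intro c v hv φ hφ i j
    have h1 : (fun x => (c • v).fst x j * partialDeriv i φ x) =ᵐ[volume.restrict Ω]
        fun x => c * (v.fst x j * partialDeriv i φ x) := by
      filter_upwards [Lp.coeFn_smul c v.fst] with x hx
      have : (c • v).fst x = c • v.fst x := hx
      rw [this, PiLp.smul_apply, smul_eq_mul]
      ring
    have h2 : (fun x => (c • v).snd x (i, j) * φ x) =ᵐ[volume.restrict Ω]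
        fun x => c * (v.snd x (i, j) * φ x) := by
      filter_upwards [Lp.coeFn_smul c v.snd] with x hx
      have : (c • v).snd x = c • v.snd x := hx
      rw [this, PiLp.smul_apply, smul_eq_mul]
      ring
    rw [integral_congr_ae h1, integral_congr_ae h2, integral_const_mul, integral_const_mul,
      hv φ hφ i j]
    ring

/-- The pairs `(φ, ∇φ)` with `φ` a smooth vector field compactly supported in `Ω`. -/
def testFields {d : ℕ} (Ω : Set (E d)) : Submodule ℝ (FieldPair Ω) where
  carrier := {v | ∃ φ : E d → E d, IsTestFunction Ω φ ∧
    (∀ᵐ x ∂(volume.restrict Ω), v.fst x = φ x) ∧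
    (∀ᵐ x ∂(volume.restrict Ω), ∀ i j : Fin d, v.snd x (i, j) = partialDeriv i φ x j)}
  zero_mem' := by
    refine ⟨fun _ => 0, ⟨contDiff_const, HasCompactSupport.zero, ?_⟩, ?_, ?_⟩
    · have : tsupport (fun _ : E d => (0 : E d)) = ∅ := tsupport_eq_empty_iff.mpr rfl
      rw [this]
      exact Set.empty_subset _
    · exact Lp.coeFn_zero (E d) 2 (volume.restrict Ω)
    · filter_upwards [Lp.coeFn_zero (Mat d) 2 (volume.restrict Ω)] with x hx i j
      have : (0 : FieldPair Ω).snd x = 0 := hx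
      rw [this]
      simp [partialDeriv]
  add_mem' := by
    rintro v w ⟨φ, hφ, h1, h2⟩ ⟨ψ, hψ, h3, h4⟩
    refine ⟨φ + ψ, ⟨hφ.1.add hψ.1, hφ.2.1.add hψ.2.1, ?_⟩, ?_, ?_⟩
    · exact (tsupport_add φ ψ).trans (Set.union_subset hφ.2.2 hψ.2.2)
    · filter_upwards [h1, h3, Lp.coeFn_add v.fst w.fst] with x a b c
      have : (v + w).fst x = v.fst x + w.fst x := c
      rw [this, a, b, Pi.add_apply]
    · filter_upwards [h2, h4, Lp.coeFn_add v.snd w.snd] with x a b c i j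
      have : (v + w).snd x = v.snd x + w.snd x := c
      rw [this, PiLp.add_apply, a, b, partialDeriv, partialDeriv, partialDeriv,
        fderiv_add ((hφ.1.differentiable (by simp)) x) ((hψ.1.differentiable (by simp)) x)]
      rfl
  smul_mem' := by
    rintro c v ⟨φ, hφ, h1, h2⟩
    refine ⟨c • φ, ⟨hφ.1.const_smul c, hφ.2.1.smul_left (f := fun _ => c), ?_⟩, ?_, ?_⟩
    · exact (tsupport_smul_subset_right (fun _ => c) φ).trans hφ.2.2
    · filter_upwards [h1, Lp.coeFn_smul c v.fst] with x a b
      have : (c • v).fst x = c • v.fst x := b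
      rw [this, a, Pi.smul_apply]
    · filter_upwards [h2, Lp.coeFn_smul c v.snd] with x a b i j
      have : (c • v).snd x = c • v.snd x := b
      rw [this, PiLp.smul_apply, a, partialDeriv, partialDeriv,
        fderiv_const_smul ((hφ.1.differentiable (by simp)) x)]
      rfl

/-- The velocity space `X = H¹_0(Ω)^d`: the fields in `H¹(Ω)^d` vanishing on `∂Ω`, that is, the
closure in `H¹` of the smooth vector fields with compact support in `Ω`. -/
def X {d : ℕ} (Ω : Set (E d)) : Submodule ℝ (FieldPair Ω) :=
  H1 Ω ⊓ (testFields Ω).topologicalClosure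

/-- The velocity field itself, as an element of `L²(Ω)^d`. Its norm is `‖v‖`. -/
def fld {d : ℕ} {Ω : Set (E d)} (v : X Ω) : L2Vec Ω := (v : FieldPair Ω).fst

/-- The weak gradient `∇v` in `L²(Ω)^{d × d}`, with entries `∂_i v_j`. Its norm is `‖∇v‖`. -/
def grad {d : ℕ} {Ω : Set (E d)} (v : X Ω) : L2Mat Ω := (v : FieldPair Ω).snd

/-- The pressure space `Q`: the fields in `L²(Ω)` with zero mean. (Integrability is automatic when
`Ω` is bounded.) -/
def Q {d : ℕ} (Ω : Set (E d)) : Submodule ℝ (L2Scalar Ω) where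
  carrier := {q | Integrable q (volume.restrict Ω) ∧ ∫ x in Ω, q x = 0}
  zero_mem' := by
    have h := Lp.coeFn_zero ℝ 2 (volume.restrict Ω)
    refine ⟨(integrable_zero _ _ _).congr h.symm, ?_⟩
    rw [integral_congr_ae h]
    simp
  add_mem' := by
    rintro p q ⟨hp, hp'⟩ ⟨hq, hq'⟩
    have h := Lp.coeFn_add p q
    refine ⟨(hp.add hq).congr h.symm, ?_⟩
    rw [integral_congr_ae h]
    simp only [Pi.add_apply]
    rw [integral_add hp hq, hp', hq', add_zero]
  smul_mem' := by
    rintro c q ⟨hq, hq'⟩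
    have h := Lp.coeFn_smul c q
    refine ⟨(hq.smul c).congr h.symm, ?_⟩
    rw [integral_congr_ae h]
    simp only [Pi.smul_apply, smul_eq_mul]
    rw [integral_const_mul, hq', mul_zero]

/-- The `L²` product `(q, ∇ · v)`. -/
def pressureDiv {d : ℕ} {Ω : Set (E d)} (q : Q Ω) (v : X Ω) : ℝ :=
  ∫ x in Ω, (q : L2Scalar Ω) x * ∑ i : Fin d, grad v x (i, i)

/-- `((u · ∇) v, w) = ∫_Ω Σ_{i,j} u_i (∂_i v_j) w_j`. -/
def convection {d : ℕ} {Ω : Set (E d)} (u v w : X Ω) : ℝ :=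
  ∫ x in Ω, ∑ j : Fin d, (∑ i : Fin d, fld u x i * grad v x (i, j)) * fld w x j

/-- The skew-symmetric trilinear form `b(u,v,w) = ½((u · ∇)v, w) - ½((u · ∇)w, v)`. -/
def b {d : ℕ} {Ω : Set (E d)} (u v w : X Ω) : ℝ :=
  1 / 2 * convection u v w - 1 / 2 * convection u w v

/-- The dual space `X⁻¹` of `X`. -/
abbrev XDual {d : ℕ} (Ω : Set (E d)) : Type := StrongDual ℝ (X Ω)

/-- The dual norm `‖g‖₋₁ = sup_{0 ≠ v ∈ X} (g, v) / ‖∇v‖`. -/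
def dualNorm {d : ℕ} {Ω : Set (E d)} (g : XDual Ω) : ℝ :=
  sSup {r : ℝ | ∃ v : X Ω, v ≠ 0 ∧ r = g v / ‖grad v‖}

/-- The inverse inequality `‖∇v‖ ≤ c h⁻¹ ‖v‖` on the discrete velocity space. -/
def InverseInequality {d : ℕ} {Ω : Set (E d)} (Xh : Submodule ℝ (X Ω)) (c h : ℝ) : Prop :=
  ∀ v ∈ Xh, ‖grad v‖ ≤ c * h⁻¹ * ‖fld v‖

/-! ### Time grids and the coefficients of the DLN method -/

/-- A time grid `0 = t_0 < t_1 < ⋯ < t_N = T`. Only the values `t n` with `n ≤ N` matter. -/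
structure TimeGrid (N : ℕ) (T : ℝ) where
  t : ℕ → ℝ
  t_zero : t 0 = 0
  t_last : t N = T
  t_lt : ∀ n < N, t n < t (n + 1)

/-- The time step `k_n = t_{n+1} - t_n`. -/
def TimeGrid.k {N : ℕ} {T : ℝ} (τ : TimeGrid N T) (n : ℕ) : ℝ := τ.t (n + 1) - τ.t n

/-- The step variability `ε_n = (k_n - k_{n-1}) / (k_n + k_{n-1})`, for `n ≥ 1`. -/
def TimeGrid.ε {N : ℕ} {T : ℝ} (τ : TimeGrid N T) (n : ℕ) : ℝ :=
  (τ.k n - τ.k (n - 1)) / (τ.k n + τ.k (n - 1))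

def α₂ (θ : ℝ) : ℝ := 1 / 2 * (θ + 1)

def α₁ (θ : ℝ) : ℝ := -θ

def α₀ (θ : ℝ) : ℝ := 1 / 2 * (θ - 1)

/-- `β_2^{(n)}` as a function of `θ` and `ε = ε_n`. -/
def β₂ (θ ε : ℝ) : ℝ :=
  1 / 4 * (1 + (1 - θ ^ 2) / (1 + ε * θ) ^ 2
    + ε ^ 2 * (θ * (1 - θ ^ 2) / (1 + ε * θ) ^ 2) + θ)

/-- `β_1^{(n)}` as a function of `θ` and `ε = ε_n`. -/
def β₁ (θ ε : ℝ) : ℝ := 1 / 2 * (1 - (1 - θ ^ 2) / (1 + ε * θ) ^ 2)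

/-- `β_0^{(n)}` as a function of `θ` and `ε = ε_n`. -/
def β₀ (θ ε : ℝ) : ℝ :=
  1 / 4 * (1 + (1 - θ ^ 2) / (1 + ε * θ) ^ 2
    - ε ^ 2 * (θ * (1 - θ ^ 2) / (1 + ε * θ) ^ 2) - θ)

/-- The average time step `k̂_n = α_2 k_n - α_0 k_{n-1}`, for `n ≥ 1`. -/
def TimeGrid.khat {N : ℕ} {T : ℝ} (τ : TimeGrid N T) (θ : ℝ) (n : ℕ) : ℝ :=
  α₂ θ * τ.k n - α₀ θ * τ.k (n - 1)

/-- `z_{n,α} = α_2 z_{n+1} + α_1 z_n + α_0 z_{n-1}`, for `n ≥ 1`. -/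
def alphaComb {V : Type} [AddCommGroup V] [Module ℝ V] (θ : ℝ) (z : ℕ → V) (n : ℕ) : V :=
  α₂ θ • z (n + 1) + α₁ θ • z n + α₀ θ • z (n - 1)

/-- `z_{n,β} = β_2^{(n)} z_{n+1} + β_1^{(n)} z_n + β_0^{(n)} z_{n-1}`, for `n ≥ 1`. -/
def betaComb {V : Type} [AddCommGroup V] [Module ℝ V] {N : ℕ} {T : ℝ} (τ : TimeGrid N T)
    (θ : ℝ) (z : ℕ → V) (n : ℕ) : V :=
  β₂ θ (τ.ε n) • z (n + 1) + β₁ θ (τ.ε n) • z n + β₀ θ (τ.ε n) • z (n - 1)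

/-- `z_{n,∗} = (β_2^{(n)}(1 + k_n/k_{n-1}) + β_1^{(n)}) z_n + (β_0^{(n)} - β_2^{(n)} k_n/k_{n-1}) z_{n-1}`,
for `n ≥ 1`. -/
def starComb {V : Type} [AddCommGroup V] [Module ℝ V] {N : ℕ} {T : ℝ} (τ : TimeGrid N T)
    (θ : ℝ) (z : ℕ → V) (n : ℕ) : V :=
  (β₂ θ (τ.ε n) * (1 + τ.k n / τ.k (n - 1)) + β₁ θ (τ.ε n)) • z n
    + (β₀ θ (τ.ε n) - β₂ θ (τ.ε n) * (τ.k n / τ.k (n - 1))) • z (n - 1)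

/-- The second difference `U_n = (1-ε_n)/2 z_{n+1} - z_n + (1+ε_n)/2 z_{n-1}`, for `n ≥ 1`. -/
def secondDiff {V : Type} [AddCommGroup V] [Module ℝ V] {N : ℕ} {T : ℝ} (τ : TimeGrid N T)
    (z : ℕ → V) (n : ℕ) : V :=
  ((1 - τ.ε n) / 2) • z (n + 1) - z n + ((1 + τ.ε n) / 2) • z (n - 1)

/-- The ensemble average `⟨z⟩_n = (1/J) Σ_j z_n^j`. -/
def ensembleAvg {V : Type} [AddCommGroup V] [Module ℝ V] {J : ℕ} (z : Fin J → ℕ → V) (n : ℕ) : V :=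
  (1 / (J : ℝ)) • ∑ j : Fin J, z j n

/-- The discrete norm `‖|f|‖_{2,-1,β} = (Σ_{n=1}^{N-1} (k_n + k_{n-1}) ‖f(t_{n,β})‖₋₁²)^{1/2}`. -/
def discreteDualNorm {d : ℕ} {Ω : Set (E d)} {N : ℕ} {T : ℝ} (τ : TimeGrid N T) (θ : ℝ)
    (f : ℝ → XDual Ω) : ℝ :=
  Real.sqrt (∑ n ∈ Finset.Icc 1 (N - 1),
    (τ.k n + τ.k (n - 1)) * dualNorm (f (betaComb τ θ τ.t n)) ^ 2)

/-! ### The algorithm -/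

/-- `(u, p)` is a solution of the fully discrete DLN-Ensemble algorithm with parameter `θ`,
viscosity `ν`, discrete spaces `Xh`, `Qh`, time grid `τ` and body forces `f`. -/
structure IsDLNEnsembleSolution {d : ℕ} {Ω : Set (E d)} (Xh : Submodule ℝ (X Ω))
    (Qh : Submodule ℝ (Q Ω)) (θ ν : ℝ) {N : ℕ} {T : ℝ} (τ : TimeGrid N T) {J : ℕ}
    (f : Fin J → ℝ → XDual Ω) (u : Fin J → ℕ → X Ω) (p : Fin J → ℕ → Q Ω) : Prop where
  velocity_mem : ∀ j, ∀ n ≤ N, u j n ∈ Xh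
  pressure_mem : ∀ j, ∀ n ≤ N, p j n ∈ Qh
  momentum : ∀ j, ∀ n, 1 ≤ n → n ≤ N - 1 → ∀ v ∈ Xh,
    inner ℝ (fld ((τ.khat θ n)⁻¹ • alphaComb θ (u j) n)) (fld v)
      + b (starComb τ θ (ensembleAvg u) n) (betaComb τ θ (u j) n) v
      - pressureDiv (betaComb τ θ (p j) n) v
      + ν * inner ℝ (grad (betaComb τ θ (u j) n)) (grad v)
    = f j (betaComb τ θ τ.t n) v
      - b (starComb τ θ (u j) n - starComb τ θ (ensembleAvg u) n) (starComb τ θ (u j) n) v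
  incompressible : ∀ j, ∀ n, 1 ≤ n → n ≤ N - 1 → ∀ q ∈ Qh,
    pressureDiv q (betaComb τ θ (u j) n) = 0

/-- The CFL-like conditions with constant `c`: for all `j` and `1 ≤ n ≤ N - 1`,
`1 - c ((1 + ε_n θ)/(1 - ε_n))² k̂_n/(h ν) ‖∇(u_{n,∗}^j - ⟨u⟩_{n,∗})‖² ≥ 0`. -/
def CFLCondition {d : ℕ} {Ω : Set (E d)} (c h θ ν : ℝ) {N : ℕ} {T : ℝ} (τ : TimeGrid N T)
    {J : ℕ} (u : Fin J → ℕ → X Ω) : Prop :=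
  ∀ j, ∀ n, 1 ≤ n → n ≤ N - 1 →
    0 ≤ 1 - c * ((1 + τ.ε n * θ) / (1 - τ.ε n)) ^ 2 * (τ.khat θ n / (h * ν))
      * ‖grad (starComb τ θ (u j) n - starComb τ θ (ensembleAvg u) n)‖ ^ 2

end DLNEnsemble

end

/-!
The stability estimate is an energy estimate: the momentum equation is tested with `u_{n,β}` and
multiplied by `k̂_n`. The time difference is handled by the `G`-stability of the DLN method
(`inner_dln_combination`), which gives the increment of the energy
`(1+θ)/4 ‖u_{n+1}‖² + (1-θ)/4 ‖u_n‖²` and twice the numerical dissipation that appears in the claim.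
The pressure drops out by discrete incompressibility, the implicit convection term by skew-symmetry,
and the forcing is bounded by `‖f‖₋₁ ‖∇u_{n,β}‖`.

What remains is the explicit fluctuation term `b(u', u_{n,∗}, u_{n,β})` with
`u' = u_{n,∗} - ⟨u⟩_{n,∗}`. Since `u_{n,∗} = u_{n,β} - 2β₂/(1-ε_n) U_n` (`starComb_eq`), it is a
multiple of `b(u', U_n, u_{n,β})`. The bound
`|b(u,v,w)| ≤ K ‖∇u‖ ‖∇w‖ (‖∇v‖ ‖v‖)^{1/2}` (`exists_abs_b_le`) and the inverse inequality estimate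
it by `‖∇u'‖ h^{-1/2} ‖U_n‖ ‖∇u_{n,β}‖`, and Young's inequality together with the CFL-like condition
splits this between the viscous term and the numerical dissipation `‖U_n‖²`. Summation over `n`
telescopes.

The bound on `b` needs only half a derivative of `v`. It comes from integration by parts
(`coordInt_by_parts`, proved for smooth fields and extended by density), the embedding
`H¹_0 ⊂ L⁶` in dimensions two and three (`exists_isSobolevConstant`), and Hölder's inequality
(`lintegral_enorm_mul_mul_le`).
-/

namespace DLNEnsemble

open scoped ENNReal NNReal

/-! ### A trilinear Hölder inequality -/

/-- Hölder's inequality with exponents `6, 2, 12, 4`, the last factor being split as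
`h = h^{1/2} h^{1/2}`. This gives `‖f‖₆ ‖g‖₂ ‖h‖₃` with `‖h‖₃` already interpolated between `L⁶` and
`L²`. -/
theorem lintegral_enorm_mul_mul_le {α F G H : Type*} [MeasurableSpace α] {μ : Measure α}
    [NormedAddCommGroup F] [NormedAddCommGroup G] [NormedAddCommGroup H]
    {f : α → F} {g : α → G} {h : α → H} (hf : AEStronglyMeasurable f μ)
    (hg : AEStronglyMeasurable g μ) (hh : AEStronglyMeasurable h μ) :
    ∫⁻ x, ‖f x‖ₑ * ‖g x‖ₑ * ‖h x‖ₑ ∂μ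
      ≤ eLpNorm f 6 μ * eLpNorm g 2 μ * (eLpNorm h 6 μ * eLpNorm h 2 μ) ^ (1 / 2 : ℝ) := by
  have key := ENNReal.lintegral_prod_norm_pow_le (μ := μ) (Finset.univ : Finset (Fin 4))
    (f := ![fun x => ‖f x‖ₑ ^ (6 : ℝ), fun x => ‖g x‖ₑ ^ (2 : ℝ), fun x => ‖h x‖ₑ ^ (6 : ℝ),
      fun x => ‖h x‖ₑ ^ (2 : ℝ)]) (p := ![1 / 6, 1 / 2, 1 / 12, 1 / 4])
    (by
      intro i _
      fin_cases i
      · exact hf.enorm.pow_const _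
      · exact hg.enorm.pow_const _
      · exact hh.enorm.pow_const _
      · exact hh.enorm.pow_const _)
    (by simp only [Fin.sum_univ_four, Matrix.cons_val]; norm_num)
    (by intro i _; fin_cases i <;> norm_num)
  simp only [Fin.prod_univ_four, Matrix.cons_val] at key
  have e1 : ∀ x, ‖f x‖ₑ * ‖g x‖ₑ * ‖h x‖ₑ = (‖f x‖ₑ ^ (6 : ℝ)) ^ (1 / 6 : ℝ) *
      (‖g x‖ₑ ^ (2 : ℝ)) ^ (1 / 2 : ℝ) * (‖h x‖ₑ ^ (6 : ℝ)) ^ (1 / 12 : ℝ) *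
      (‖h x‖ₑ ^ (2 : ℝ)) ^ (1 / 4 : ℝ) := by
    intro x
    simp only [← ENNReal.rpow_mul]
    rw [mul_assoc _ (‖h x‖ₑ ^ _), ← ENNReal.rpow_add_of_nonneg _ _ (by norm_num) (by norm_num)]
    norm_num
  simp only [e1]
  refine key.trans (le_of_eq ?_)
  rw [eLpNorm_eq_lintegral_rpow_enorm_toReal (f := f) (by norm_num) (by norm_num),
    eLpNorm_eq_lintegral_rpow_enorm_toReal (f := g) (by norm_num) (by norm_num),
    eLpNorm_eq_lintegral_rpow_enorm_toReal (f := h) (p := 6) (by norm_num) (by norm_num),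
    eLpNorm_eq_lintegral_rpow_enorm_toReal (f := h) (p := 2) (by norm_num) (by norm_num),
    ENNReal.mul_rpow_of_nonneg _ _ (by norm_num), ← ENNReal.rpow_mul, ← ENNReal.rpow_mul]
  norm_num [mul_assoc]

variable {d : ℕ} {Ω : Set (E d)}

/-! ### The Sobolev and Poincaré inequalities on `H¹_0(Ω)^d` -/

/-- The closure of the smooth compactly supported fields in the space of pairs `(u, G)`. It contains
`X Ω`, and it is where all estimates on velocities are proved: membership in `H1 Ω` is never
needed. -/
noncomputable abbrev testClosure (Ω : Set (E d)) : Submodule ℝ (FieldPair Ω) :=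
  (testFields Ω).topologicalClosure

theorem norm_fst_le (v : FieldPair Ω) : ‖v.fst‖ ≤ ‖v‖ := by
  rw [WithLp.prod_norm_eq_of_L2]
  exact Real.le_sqrt_of_sq_le (by nlinarith [sq_nonneg ‖v.snd‖])

theorem norm_snd_le (v : FieldPair Ω) : ‖v.snd‖ ≤ ‖v‖ := by
  rw [WithLp.prod_norm_eq_of_L2]
  exact Real.le_sqrt_of_sq_le (by nlinarith [sq_nonneg ‖v.fst‖])

/-- The operator norm of the derivative is controlled by the Frobenius norm of the Jacobian (with a
non-sharp factor `d`). -/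
theorem norm_fderiv_le (φ : E d → E d) (A : Mat d) (x : E d)
    (h : ∀ i j, A (i, j) = partialDeriv i φ x j) : ‖fderiv ℝ φ x‖ ≤ d * ‖A‖ := by
  have hi : ∀ i, ‖partialDeriv i φ x‖ ≤ ‖A‖ := by
    intro i
    rw [EuclideanSpace.norm_eq, EuclideanSpace.norm_eq]
    refine Real.sqrt_le_sqrt ?_
    rw [Fintype.sum_prod_type]
    simp only [h]
    exact Finset.single_le_sum (f := fun k => ∑ j, ‖partialDeriv k φ x j‖ ^ 2)
      (fun k _ => by positivity) (Finset.mem_univ i)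
  refine ContinuousLinearMap.opNorm_le_bound _ (by positivity) fun y => ?_
  have hy : y = ∑ i, y i • EuclideanSpace.single i (1 : ℝ) := by
    ext k
    simp [Finset.sum_apply, Pi.single_apply]
  have : fderiv ℝ φ x y = ∑ i, y i • partialDeriv i φ x := by
    conv_lhs => rw [hy]
    simp [partialDeriv]
  rw [this]
  calc ‖∑ i, y i • partialDeriv i φ x‖ ≤ ∑ i : Fin d, ‖A‖ * ‖y‖ := by
        refine norm_sum_le_of_le _ fun i _ => ?_
        rw [norm_smul, mul_comm]
        exact mul_le_mul (hi i) (PiLp.norm_apply_le y i) (norm_nonneg _) (norm_nonneg _)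
    _ = d * ‖A‖ * ‖y‖ := by simp [mul_assoc]

/-- The embedding into `L⁶` for smooth fields, from the Gagliardo-Nirenberg-Sobolev inequality. -/
theorem eLpNorm_six_le_of_mem_testFields (hd : d = 2 ∨ d = 3) (hΩ : Bornology.IsBounded Ω) :
    ∃ K : ℝ≥0, ∀ v ∈ testFields Ω,
      eLpNorm v.fst 6 (volume.restrict Ω) ≤ K * eLpNorm v.snd 2 (volume.restrict Ω) := by
  -- The exponent `2` is critical in dimension two, so there the inequality is used with
  -- `p = 3/2`, and Hölder's inequality on the bounded set `Ω` raises `p` to `2`.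
  obtain ⟨p, hp1, hp2, hpd, hp6⟩ : ∃ p : ℝ≥0, 1 ≤ p ∧ p ≤ 2 ∧ p < (d : ℝ≥0) ∧
      (p : ℝ)⁻¹ - (d : ℝ)⁻¹ ≤ (6 : ℝ)⁻¹ := by
    rcases hd with rfl | rfl
    · refine ⟨3 / 2, ?_, ?_, ?_, by norm_num⟩ <;>
        first | rw [← NNReal.coe_le_coe] | rw [← NNReal.coe_lt_coe]
      all_goals norm_num
    · refine ⟨2, ?_, ?_, ?_, by norm_num⟩ <;> norm_num
  have : IsFiniteMeasure (volume.restrict Ω) := ⟨by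
    rw [Measure.restrict_apply_univ]; exact hΩ.measure_lt_top⟩
  set m : ℝ≥0∞ := (volume.restrict Ω) Set.univ ^ (1 / (p : ℝ≥0∞).toReal - 1 / (2 : ℝ≥0∞).toReal)
    with hm
  have hmtop : m ≠ ⊤ := by
    refine ENNReal.rpow_ne_top_of_nonneg ?_ (measure_ne_top _ _)
    have : (0 : ℝ) < p := lt_of_lt_of_le one_pos hp1
    have h2 : (p : ℝ) ≤ 2 := hp2
    simp only [ENNReal.coe_toReal, ENNReal.toReal_ofNat]
    linarith [one_div_le_one_div_of_le this h2]
  refine ⟨eLpNormLESNormFDerivOfLeConst (E d) (volume : Measure (E d)) Ω p 6 * m.toNNReal * d, ?_⟩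
  rintro v ⟨φ, hφ, h1, h2⟩
  have hs : Function.support φ ⊆ Ω := (subset_tsupport φ).trans hφ.2.2
  have hsf : Function.support (fderiv ℝ φ) ⊆ Ω := (support_fderiv_subset ℝ).trans hφ.2.2
  have hc : Continuous (fderiv ℝ φ) := hφ.1.continuous_fderiv (by simp)
  rw [eLpNorm_congr_ae h1]
  have gns := eLpNorm_le_eLpNorm_fderiv_of_le (volume : Measure (E d)) (u := φ) (s := Ω)
    (hφ.1.of_le (by simp)) hs (p := p) (q := 6) hp1 (by simpa using hpd) (by simpa using hp6) hΩ
  calc eLpNorm φ 6 (volume.restrict Ω) ≤ eLpNorm φ 6 volume := eLpNorm_restrict_le _ _ _ _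
    _ ≤ _ := gns
    _ = eLpNormLESNormFDerivOfLeConst (E d) (volume : Measure (E d)) Ω p 6
          * eLpNorm (fderiv ℝ φ) p (volume.restrict Ω) := by
        exact congrArg _ (eLpNorm_restrict_eq_of_support_subset hsf).symm
    _ ≤ eLpNormLESNormFDerivOfLeConst (E d) (volume : Measure (E d)) Ω p 6
          * (d * eLpNorm v.snd 2 (volume.restrict Ω) * m) := by
        gcongr
        refine (eLpNorm_le_eLpNorm_mul_rpow_measure_univ (q := 2) (by exact_mod_cast hp2)
          hc.aestronglyMeasurable).trans ?_
        gcongr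
        have := eLpNorm_le_nnreal_smul_eLpNorm_of_ae_le_mul (f := fderiv ℝ φ) (g := v.snd)
          (c := (d : ℝ≥0)) (μ := volume.restrict Ω) (p := 2) (by
            filter_upwards [h2] with x hx
            exact_mod_cast norm_fderiv_le φ (v.snd x) x hx)
        simpa [ENNReal.smul_def] using this
    _ = _ := by
        push_cast
        rw [ENNReal.coe_toNNReal hmtop]
        ring

/-- `K` is a constant for the embedding of `H¹_0(Ω)^d` into `L⁶(Ω)^d`. -/
def IsSobolevConstant (Ω : Set (E d)) (K : ℝ≥0) : Prop :=
  ∀ v ∈ testClosure Ω,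
    eLpNorm v.fst 6 (volume.restrict Ω) ≤ ENNReal.ofReal (K * ‖v.snd‖)

theorem exists_isSobolevConstant (hd : d = 2 ∨ d = 3) (hΩ : Bornology.IsBounded Ω) :
    ∃ K : ℝ≥0, IsSobolevConstant Ω K := by
  obtain ⟨K, hK⟩ := eLpNorm_six_le_of_mem_testFields hd hΩ
  refine ⟨K, fun v hv => ?_⟩
  obtain ⟨w, hw, hlim⟩ := mem_closure_iff_seq_limit.mp hv
  have hfst : Filter.Tendsto (fun n => (w n).fst) Filter.atTop (nhds v.fst) :=
    ((WithLp.prod_continuous_ofLp 2 _ _).fst.tendsto v).comp hlim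
  have hsnd : Filter.Tendsto (fun n => (w n).snd) Filter.atTop (nhds v.snd) :=
    ((WithLp.prod_continuous_ofLp 2 _ _).snd.tendsto v).comp hlim
  have hnorm : Filter.Tendsto (fun n => ENNReal.ofReal (K * ‖(w n).snd‖)) Filter.atTop
      (nhds (ENNReal.ofReal (K * ‖v.snd‖))) :=
    (ENNReal.continuous_ofReal.tendsto _).comp (hsnd.norm.const_mul _)
  -- Lower semicontinuity of the `L⁶` norm under convergence in measure.
  refine le_of_forall_gt_imp_ge_of_dense fun c hc => ?_
  refine eLpNorm_le_of_tendstoInMeasure (f := fun n => ((w n).fst : E d → E d)) ?_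
    (tendstoInMeasure_of_tendsto_Lp hfst) fun n => Lp.aestronglyMeasurable _
  filter_upwards [hnorm.eventually_lt_const hc] with n hn
  refine (hK _ (hw n)).trans (le_trans (le_of_eq ?_) hn.le)
  rw [ENNReal.ofReal_mul K.coe_nonneg, Lp.norm_def, ENNReal.ofReal_toReal (Lp.eLpNorm_ne_top _)]
  simp

/-- The Poincaré inequality. -/
theorem exists_norm_fst_le_norm_snd (hd : d = 2 ∨ d = 3) (hΩ : Bornology.IsBounded Ω) :
    ∃ K : ℝ, ∀ v ∈ testClosure Ω, ‖v.fst‖ ≤ K * ‖v.snd‖ := by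
  obtain ⟨K, hK⟩ := exists_isSobolevConstant hd hΩ
  have : IsFiniteMeasure (volume.restrict Ω) := ⟨by
    rw [Measure.restrict_apply_univ]; exact hΩ.measure_lt_top⟩
  set m : ℝ≥0∞ := (volume.restrict Ω) Set.univ ^ (1 / (2 : ℝ≥0∞).toReal - 1 / (6 : ℝ≥0∞).toReal)
    with hm
  have hmtop : m ≠ ⊤ := ENNReal.rpow_ne_top_of_nonneg (by norm_num) (measure_ne_top _ _)
  refine ⟨K * m.toReal, fun v hv => ?_⟩
  rw [Lp.norm_def]
  refine ENNReal.toReal_le_of_le_ofReal (by positivity) ?_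
  calc eLpNorm v.fst 2 (volume.restrict Ω) ≤ eLpNorm v.fst 6 (volume.restrict Ω) * m :=
        eLpNorm_le_eLpNorm_mul_rpow_measure_univ (by norm_num) (Lp.aestronglyMeasurable _)
    _ ≤ ENNReal.ofReal (K * ‖v.snd‖) * m := by gcongr; exact hK v hv
    _ = ENNReal.ofReal (K * m.toReal * ‖v.snd‖) := by
        rw [mul_right_comm, ENNReal.ofReal_mul (p := K * ‖v.snd‖) (by positivity), ENNReal.ofReal_toReal hmtop]

/-! ### The scalar trilinear integrals behind the convection term -/

/-- The integral `∫_Ω u_i (∇v)_m w_j`, where `m` is a pair of indices. Every trilinear integral in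
the argument, including those containing `∇ · u`, is a finite sum of these. -/
noncomputable def coordInt (i : Fin d) (m : Fin d × Fin d) (j : Fin d) (u v w : FieldPair Ω) : ℝ :=
  ∫ x in Ω, u.fst x i * v.snd x m * w.fst x j

theorem aestronglyMeasurable_coord {ι : Type*} [Fintype ι]
    (f : Lp (EuclideanSpace ℝ ι) 2 (volume.restrict Ω)) (i : ι) :
    AEStronglyMeasurable (fun x => f x i) (volume.restrict Ω) :=
  (EuclideanSpace.proj (𝕜 := ℝ) i : EuclideanSpace ℝ ι →L[ℝ] ℝ).continuous.comp_aestronglyMeasurable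
    (Lp.aestronglyMeasurable f)

/-- The absolute integrals are finite, so that `coordInt` is a genuine integral. The factor `w`
enters only through `(‖∇w‖ ‖w‖)^{1/2}`. -/
theorem lintegral_coord_le {K : ℝ≥0} (hK : IsSobolevConstant Ω K)
    {u v w : FieldPair Ω} (hu : u ∈ testClosure Ω) (hw : w ∈ testClosure Ω)
    (i : Fin d) (m : Fin d × Fin d) (j : Fin d) :
    ∫⁻ x in Ω, ‖u.fst x i * v.snd x m * w.fst x j‖ₑ
      ≤ ENNReal.ofReal ((K * ‖u.snd‖) * ‖v.snd‖ * √(K * ‖w.snd‖ * ‖w.fst‖)) := by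
  have hpt : ∀ {ι : Type} [Fintype ι] (y : EuclideanSpace ℝ ι) (i : ι), ‖y i‖ₑ ≤ ‖y‖ₑ :=
    fun y i => enorm_le_iff_norm_le.mpr (PiLp.norm_apply_le y i)
  have hL : ∀ {F : Type} [NormedAddCommGroup F] (f : Lp F 2 (volume.restrict Ω)),
      eLpNorm f 2 (volume.restrict Ω) = ENNReal.ofReal ‖f‖ := fun f => by
    rw [Lp.norm_def, ENNReal.ofReal_toReal (Lp.eLpNorm_ne_top _)]
  calc ∫⁻ x in Ω, ‖u.fst x i * v.snd x m * w.fst x j‖ₑ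
      ≤ ∫⁻ x in Ω, ‖u.fst x‖ₑ * ‖v.snd x‖ₑ * ‖w.fst x‖ₑ := by
        refine lintegral_mono fun x => ?_
        simp only [enorm_mul]
        gcongr <;> exact hpt _ _
    _ ≤ _ := lintegral_enorm_mul_mul_le (Lp.aestronglyMeasurable _) (Lp.aestronglyMeasurable _)
        (Lp.aestronglyMeasurable _)
    _ ≤ ENNReal.ofReal (K * ‖u.snd‖) * ENNReal.ofReal ‖v.snd‖
          * (ENNReal.ofReal (K * ‖w.snd‖) * ENNReal.ofReal ‖w.fst‖) ^ (1 / 2 : ℝ) := by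
        rw [hL, hL]
        gcongr
        · exact hK u hu
        · exact hK w hw
    _ = _ := by
        rw [← ENNReal.ofReal_mul (by positivity), ← ENNReal.ofReal_mul (by positivity),
          ENNReal.ofReal_rpow_of_nonneg (by positivity) (by norm_num),
          ← ENNReal.ofReal_mul (by positivity), Real.sqrt_eq_rpow]

theorem integrable_coord {K : ℝ≥0} (hK : IsSobolevConstant Ω K)
    {u v w : FieldPair Ω} (hu : u ∈ testClosure Ω) (hw : w ∈ testClosure Ω)
    (i : Fin d) (m : Fin d × Fin d) (j : Fin d) :
    Integrable (fun x => u.fst x i * v.snd x m * w.fst x j) (volume.restrict Ω) :=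
  ⟨((aestronglyMeasurable_coord _ i).mul (aestronglyMeasurable_coord _ m)).mul
    (aestronglyMeasurable_coord _ j),
    (lintegral_coord_le hK hu hw i m j).trans_lt ENNReal.ofReal_lt_top⟩

theorem abs_coordInt_le {K : ℝ≥0} (hK : IsSobolevConstant Ω K)
    {u v w : FieldPair Ω} (hu : u ∈ testClosure Ω) (hw : w ∈ testClosure Ω)
    (i : Fin d) (m : Fin d × Fin d) (j : Fin d) :
    |coordInt i m j u v w| ≤ (K * ‖u.snd‖) * ‖v.snd‖ * √(K * ‖w.snd‖ * ‖w.fst‖) := by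
  have h := (enorm_integral_le_lintegral_enorm _).trans (lintegral_coord_le (v := v) hK hu hw i m j)
  rw [← ofReal_norm, ENNReal.ofReal_le_ofReal_iff (by positivity)] at h
  exact h

theorem abs_coordInt_le_norm {K : ℝ≥0} (hK : IsSobolevConstant Ω K)
    {u v w : FieldPair Ω} (hu : u ∈ testClosure Ω) (hw : w ∈ testClosure Ω)
    (i : Fin d) (m : Fin d × Fin d) (j : Fin d) :
    |coordInt i m j u v w| ≤ K * √K * ‖u‖ * ‖v‖ * ‖w‖ := by
  refine (abs_coordInt_le hK hu hw i m j).trans ?_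
  have : √(K * ‖w.snd‖ * ‖w.fst‖) ≤ √K * ‖w‖ := by
    rw [mul_assoc, Real.sqrt_mul K.coe_nonneg]
    gcongr
    rw [Real.sqrt_le_left (norm_nonneg _), sq]
    gcongr
    · exact norm_snd_le w
    · exact norm_fst_le w
  calc _ ≤ (K * ‖u‖) * ‖v‖ * (√K * ‖w‖) := by
        gcongr
        · exact norm_snd_le u
        · exact norm_snd_le v
    _ = _ := by ring

theorem coordInt_sub_left {K : ℝ≥0} (hK : IsSobolevConstant Ω K)
    {u u' v w : FieldPair Ω} (hu : u ∈ testClosure Ω) (hu' : u' ∈ testClosure Ω)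
    (hw : w ∈ testClosure Ω) (i : Fin d) (m : Fin d × Fin d) (j : Fin d) :
    coordInt i m j (u - u') v w = coordInt i m j u v w - coordInt i m j u' v w := by
  unfold coordInt
  rw [← integral_sub (integrable_coord hK hu hw i m j) (integrable_coord hK hu' hw i m j)]
  refine integral_congr_ae ?_
  filter_upwards [Lp.coeFn_sub u.fst u'.fst] with x hx
  have : (u - u').fst x = u.fst x - u'.fst x := hx
  rw [this, PiLp.sub_apply]
  ring

theorem coordInt_sub_smul_mid {K : ℝ≥0} (hK : IsSobolevConstant Ω K)
    {u v v' w : FieldPair Ω} (hu : u ∈ testClosure Ω) (hw : w ∈ testClosure Ω)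
    (c : ℝ) (i : Fin d) (m : Fin d × Fin d) (j : Fin d) :
    coordInt i m j u (v - c • v') w = coordInt i m j u v w - c * coordInt i m j u v' w := by
  unfold coordInt
  rw [← integral_const_mul, ← integral_sub (integrable_coord hK hu hw i m j)
    ((integrable_coord hK hu hw i m j).const_mul c)]
  refine integral_congr_ae ?_
  filter_upwards [Lp.coeFn_sub v.snd (c • v'.snd), Lp.coeFn_smul c v'.snd] with x hx hc
  have h : (v - c • v').snd x = v.snd x - c • v'.snd x := by
    rw [← Pi.smul_apply c (v'.snd : E d → Mat d), ← hc]; exact hx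
  rw [h, PiLp.sub_apply, PiLp.smul_apply, smul_eq_mul]
  ring

theorem coordInt_sub_smul_right {K : ℝ≥0} (hK : IsSobolevConstant Ω K)
    {u v w w' : FieldPair Ω} (hu : u ∈ testClosure Ω) (hw : w ∈ testClosure Ω)
    (hw' : w' ∈ testClosure Ω) (c : ℝ) (i : Fin d) (m : Fin d × Fin d) (j : Fin d) :
    coordInt i m j u v (w - c • w') = coordInt i m j u v w - c * coordInt i m j u v w' := by
  unfold coordInt
  rw [← integral_const_mul, ← integral_sub (integrable_coord hK hu hw i m j)
    ((integrable_coord hK hu hw' i m j).const_mul c)]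
  refine integral_congr_ae ?_
  filter_upwards [Lp.coeFn_sub w.fst (c • w'.fst), Lp.coeFn_smul c w'.fst] with x hx hc
  have h : (w - c • w').fst x = w.fst x - c • w'.fst x := by
    rw [← Pi.smul_apply c (w'.fst : E d → E d), ← hc]; exact hx
  rw [h, PiLp.sub_apply, PiLp.smul_apply, smul_eq_mul]
  ring

/-- A bounded additive functional vanishing on test fields vanishes on their closure. -/
theorem eq_zero_of_mem_testClosure {F : FieldPair Ω → ℝ} {K : ℝ}
    (hsub : ∀ v ∈ testClosure Ω, ∀ w ∈ testClosure Ω, F (v - w) = F v - F w)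
    (hle : ∀ v ∈ testClosure Ω, |F v| ≤ K * ‖v‖) (hF : ∀ v ∈ testFields Ω, F v = 0)
    {v : FieldPair Ω} (hv : v ∈ testClosure Ω) : F v = 0 := by
  obtain ⟨w, hw, hlim⟩ := mem_closure_iff_seq_limit.mp hv
  have hw' : ∀ n, w n ∈ testClosure Ω := fun n => (testFields Ω).le_topologicalClosure (hw n)
  have h : ∀ n, |F v| ≤ K * ‖v - w n‖ := fun n => by
    have := hle (v - w n) (sub_mem hv (hw' n))
    rwa [hsub v hv _ (hw' n), hF _ (hw n), sub_zero] at this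
  have h0 : Filter.Tendsto (fun n => K * ‖v - w n‖) Filter.atTop (nhds 0) := by
    simpa using ((tendsto_const_nhds.sub hlim).norm.const_mul K :
      Filter.Tendsto (fun n => K * ‖v - w n‖) Filter.atTop (nhds (K * ‖v - v‖)))
  exact abs_nonpos_iff.mp (ge_of_tendsto' h0 h)

/-! ### Integration by parts -/

/-- The integral of `∂_i (φ_i ψ_j χ_j)` vanishes. -/
theorem integral_testFunction_by_parts {φ ψ χ : E d → E d} (hφ : IsTestFunction Ω φ)
    (hψ : IsTestFunction Ω ψ) (hχ : IsTestFunction Ω χ) (i j : Fin d) :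
    (∫ x, φ x i * partialDeriv i ψ x j * χ x j) + (∫ x, φ x i * partialDeriv i χ x j * ψ x j)
      + ∫ x, χ x j * partialDeriv i φ x i * ψ x j = 0 := by
  have hcomp : ∀ {ζ : E d → E d} (_ : IsTestFunction Ω ζ) (k : Fin d),
      ContDiff ℝ ∞ (fun x => ζ x k) := fun h k =>
    (EuclideanSpace.proj (𝕜 := ℝ) k : E d →L[ℝ] ℝ).contDiff.comp h.1
  have hcs : ∀ {ζ : E d → E d} (_ : IsTestFunction Ω ζ) (k : Fin d),
      HasCompactSupport (fun x => ζ x k) := fun h k =>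
    h.2.1.comp_left (g := fun y : E d => y k) rfl
  have hpd : ∀ {ζ : E d → E d} (_ : IsTestFunction Ω ζ) (k l : Fin d) (x : E d),
      partialDeriv k ζ x l = fderiv ℝ (fun x => ζ x l) x (EuclideanSpace.single k 1) :=
    fun {ζ} h k l x => by
      have := ((EuclideanSpace.proj (𝕜 := ℝ) l : E d →L[ℝ] ℝ).hasFDerivAt (x := ζ x)).comp x
        (h.1.differentiable (by simp) x).hasFDerivAt
      rw [show (fun x => ζ x l) = (EuclideanSpace.proj (𝕜 := ℝ) l : E d →L[ℝ] ℝ) ∘ ζ from rfl,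
        this.fderiv]
      rfl
  simp only [hpd hφ, hpd hψ, hpd hχ]
  set e : E d := EuclideanSpace.single i 1
  set f : E d → ℝ := fun x => φ x i with hf
  set g : E d → ℝ := fun x => ψ x j with hg
  set k : E d → ℝ := fun x => χ x j with hk
  have cf := hcomp hφ i
  have cg := hcomp hψ j
  have ck := hcomp hχ j
  have df : Differentiable ℝ f := cf.differentiable (by simp)
  have dg : Differentiable ℝ g := cg.differentiable (by simp)
  have dk : Differentiable ℝ k := ck.differentiable (by simp)
  have kf : Continuous (fun x => fderiv ℝ f x e) :=
    (cf.continuous_fderiv (by simp)).clm_apply continuous_const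
  have kg : Continuous (fun x => fderiv ℝ g x e) :=
    (cg.continuous_fderiv (by simp)).clm_apply continuous_const
  have kk : Continuous (fun x => fderiv ℝ k x e) :=
    (ck.continuous_fderiv (by simp)).clm_apply continuous_const
  have hprod : ∀ x, fderiv ℝ (fun x => g x * k x) x e
      = fderiv ℝ g x e * k x + fderiv ℝ k x e * g x := fun x => by
    rw [fderiv_fun_mul (dg x) (dk x)]
    simp only [add_apply, smul_apply, smul_eq_mul]
    ring
  have hcf : HasCompactSupport f := hcs hφ i
  have i1 : Integrable (fun x => f x * fderiv ℝ g x e * k x) :=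
    ((df.continuous.mul kg).mul dk.continuous).integrable_of_hasCompactSupport
      (hcf.mul_right.mul_right)
  have i2 : Integrable (fun x => f x * fderiv ℝ k x e * g x) :=
    ((df.continuous.mul kk).mul dg.continuous).integrable_of_hasCompactSupport
      (hcf.mul_right.mul_right)
  have i3 : Integrable (fun x => f x * (g x * k x)) :=
    (df.continuous.mul (dg.continuous.mul dk.continuous)).integrable_of_hasCompactSupport
      hcf.mul_right
  have i4 : Integrable (fun x => fderiv ℝ f x e * (g x * k x)) :=
    (kf.mul (dg.continuous.mul dk.continuous)).integrable_of_hasCompactSupport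
      (hcf.fderiv_apply (𝕜 := ℝ) e).mul_right
  have i5 : Integrable (fun x => f x * fderiv ℝ (fun x => g x * k x) x e) := by
    refine (i1.add i2).congr (Filter.Eventually.of_forall fun x => ?_)
    simp only [Pi.add_apply, hprod]
    ring
  have key := integral_mul_fderiv_eq_neg_fderiv_mul_of_integrable (μ := volume) (f := f)
    (g := fun x => g x * k x) (v := e) i4 i5 i3 (fun x _ => df x) fun x _ => (dg x).mul (dk x)
  have h1 : ∫ x, f x * fderiv ℝ (fun x => g x * k x) x e
      = (∫ x, f x * fderiv ℝ g x e * k x) + ∫ x, f x * fderiv ℝ k x e * g x := by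
    rw [← integral_add i1 i2]
    exact integral_congr_ae (Filter.Eventually.of_forall fun x => by simp only [hprod]; ring)
  have h2 : ∫ x, k x * fderiv ℝ f x e * g x = ∫ x, fderiv ℝ f x e * (g x * k x) :=
    integral_congr_ae (Filter.Eventually.of_forall fun x => by ring)
  rw [← h1, key, h2]
  ring

theorem coordInt_by_parts_of_mem_testFields {u v w : FieldPair Ω} (hu : u ∈ testFields Ω)
    (hv : v ∈ testFields Ω) (hw : w ∈ testFields Ω) (i j : Fin d) :
    coordInt i (i, j) j u v w + coordInt i (i, j) j u w v + coordInt j (i, i) j w u v = 0 := by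
  obtain ⟨φ, hφ, hu1, hu2⟩ := hu
  obtain ⟨ψ, hψ, hv1, hv2⟩ := hv
  obtain ⟨χ, hχ, hw1, hw2⟩ := hw
  rw [← integral_testFunction_by_parts hφ hψ hχ i j]
  have hz : ∀ {ζ : E d → E d} (_ : IsTestFunction Ω ζ) (x) (_ : x ∉ Ω), ζ x = 0 :=
    fun h x hx => image_eq_zero_of_notMem_tsupport fun hx' => hx (h.2.2 hx')
  rw [← setIntegral_eq_integral_of_forall_compl_eq_zero (s := Ω)
      (f := fun x => φ x i * partialDeriv i ψ x j * χ x j)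
      (fun x hx => by simp [hz hφ x hx]),
    ← setIntegral_eq_integral_of_forall_compl_eq_zero (s := Ω)
      (f := fun x => φ x i * partialDeriv i χ x j * ψ x j)
      (fun x hx => by simp [hz hφ x hx]),
    ← setIntegral_eq_integral_of_forall_compl_eq_zero (s := Ω)
      (f := fun x => χ x j * partialDeriv i φ x i * ψ x j)
      (fun x hx => by simp [hz hχ x hx])]
  unfold coordInt
  congr 1
  · congr 1
    · refine integral_congr_ae ?_
      filter_upwards [hu1, hv2, hw1] with x a b c
      rw [a, b, c]
    · refine integral_congr_ae ?_
      filter_upwards [hu1, hw2, hv1] with x a b c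
      rw [a, b, c]
  · refine integral_congr_ae ?_
    filter_upwards [hw1, hu2, hv1] with x a b c
    rw [a, b, c]

/-- Integration by parts on the closure of the test fields: the identity for smooth fields extends
in one argument after the other, each time by `eq_zero_of_mem_testClosure`. -/
theorem coordInt_by_parts {K : ℝ≥0} (hK : IsSobolevConstant Ω K)
    {u v w : FieldPair Ω} (hu : u ∈ testClosure Ω) (hv : v ∈ testClosure Ω)
    (hw : w ∈ testClosure Ω) (i j : Fin d) :
    coordInt i (i, j) j u v w + coordInt i (i, j) j u w v + coordInt j (i, i) j w u v = 0 := by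
  have hm : ∀ {v u' w' : FieldPair Ω} (w : FieldPair Ω) (_ : u' ∈ testClosure Ω)
      (_ : w' ∈ testClosure Ω) (i : Fin d) (m : Fin d × Fin d) (j : Fin d),
      coordInt i m j u' (v - w) w' = coordInt i m j u' v w' - coordInt i m j u' w w' :=
    fun {v _ _} w h1 h2 i m j => by
      simpa using coordInt_sub_smul_mid (v := v) (v' := w) hK h1 h2 1 i m j
  have hr : ∀ {u' v' w w' : FieldPair Ω} (_ : u' ∈ testClosure Ω)
      (_ : w ∈ testClosure Ω) (_ : w' ∈ testClosure Ω) (i : Fin d) (m : Fin d × Fin d) (j : Fin d),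
      coordInt i m j u' v' (w - w') = coordInt i m j u' v' w - coordInt i m j u' v' w' :=
    fun {_ v' _ _} h1 h2 h3 i m j => by
      simpa using coordInt_sub_smul_right (v := v') hK h1 h2 h3 1 i m j
  set A := (K : ℝ) * √K
  set T : FieldPair Ω → FieldPair Ω → FieldPair Ω → ℝ := fun u v w =>
    coordInt i (i, j) j u v w + coordInt i (i, j) j u w v + coordInt j (i, i) j w u v with hT
  have hTle : ∀ u ∈ testClosure Ω, ∀ v ∈ testClosure Ω, ∀ w ∈ testClosure Ω,
      |T u v w| ≤ 3 * A * ‖u‖ * ‖v‖ * ‖w‖ := fun u hu v hv w hw => by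
    have a1 := abs_coordInt_le_norm (v := v) hK hu hw i (i, j) j
    have a2 := abs_coordInt_le_norm (v := w) hK hu hv i (i, j) j
    have a3 := abs_coordInt_le_norm (v := u) hK hw hv j (i, i) j
    refine (abs_add_three _ _ _).trans ?_
    calc _ ≤ _ := add_le_add (add_le_add a1 a2) a3
      _ = _ := by ring
  have ht : ∀ v ∈ testFields Ω, v ∈ testClosure Ω := fun v hv =>
    (testFields Ω).le_topologicalClosure hv
  have s1 : ∀ u ∈ testClosure Ω, ∀ v ∈ testFields Ω, ∀ w ∈ testFields Ω, T u v w = 0 := by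
    intro u hu v hv w hw
    refine eq_zero_of_mem_testClosure (F := fun u => T u v w) (K := 3 * A * ‖v‖ * ‖w‖) ?_ ?_ ?_ hu
    · intro a ha b hb
      simp only [hT]
      rw [coordInt_sub_left hK ha hb (ht w hw), coordInt_sub_left hK ha hb (ht v hv),
        hm b (ht w hw) (ht v hv)]
      ring
    · intro a ha
      exact (hTle a ha v (ht v hv) w (ht w hw)).trans (le_of_eq (by ring))
    · intro a ha
      exact coordInt_by_parts_of_mem_testFields ha hv hw i j
  have s2 : ∀ u ∈ testClosure Ω, ∀ v ∈ testClosure Ω, ∀ w ∈ testFields Ω, T u v w = 0 := by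
    intro u hu v hv w hw
    refine eq_zero_of_mem_testClosure (F := fun v => T u v w) (K := 3 * A * ‖u‖ * ‖w‖) ?_ ?_ ?_ hv
    · intro a ha b hb
      simp only [hT]
      rw [hm b hu (ht w hw), hr hu ha hb, hr (ht w hw) ha hb]
      ring
    · intro a ha
      exact (hTle u hu a ha w (ht w hw)).trans (le_of_eq (by ring))
    · intro a ha
      exact s1 u hu a ha w hw
  refine eq_zero_of_mem_testClosure (F := fun w => T u v w) (K := 3 * A * ‖u‖ * ‖v‖) ?_ ?_ ?_ hw
  · intro a ha b hb
    simp only [hT]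
    rw [hr hu ha hb, hm b hu hv, coordInt_sub_left hK ha hb hv]
    ring
  · intro a ha
    exact hTle u hu v hv a ha
  · intro a ha
    exact s2 u hu v hv a ha

/-! ### The trilinear form and the dual norm -/

theorem convection_eq_sum {K : ℝ≥0} (hK : IsSobolevConstant Ω K) (u v w : X Ω) :
    convection u v w = ∑ j, ∑ i, coordInt i (i, j) j (u : FieldPair Ω) v w := by
  have hint := fun i j => integrable_coord (v := (v : FieldPair Ω)) hK u.2.2 w.2.2 i (i, j) j
  unfold convection coordInt
  simp_rw [Finset.sum_mul]
  refine (integral_finsetSum _ fun j _ => integrable_finsetSum _ fun i _ => hint i j).trans ?_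
  refine Finset.sum_congr rfl fun j _ => ?_
  exact integral_finsetSum _ fun i _ => hint i j

/-- Skew-symmetry of `b`. -/
theorem b_self_right (u w : X Ω) : b u w w = 0 := sub_self _

theorem b_sub_smul_mid {K : ℝ≥0} (hK : IsSobolevConstant Ω K) (u v v' w : X Ω) (c : ℝ) :
    b u (v - c • v') w = b u v w - c * b u v' w := by
  have h1 : convection u (v - c • v') w = convection u v w - c * convection u v' w := by
    simp only [convection_eq_sum hK, Submodule.coe_sub, Submodule.coe_smul,
      coordInt_sub_smul_mid hK u.2.2 w.2.2, Finset.sum_sub_distrib, Finset.mul_sum]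
  have h2 : convection u w (v - c • v') = convection u w v - c * convection u w v' := by
    simp only [convection_eq_sum hK, Submodule.coe_sub, Submodule.coe_smul,
      coordInt_sub_smul_right hK u.2.2 v.2.2 v'.2.2, Finset.sum_sub_distrib, Finset.mul_sum]
  unfold b
  rw [h1, h2]
  ring

/-- Integration by parts moves the derivative off `v`:
`b(u,v,w) = -((u · ∇)w, v) - ½ ((∇ · u) w, v)`. -/
theorem b_eq_sum {K : ℝ≥0} (hK : IsSobolevConstant Ω K) (u v w : X Ω) :
    b u v w = ∑ j, ∑ i, (-coordInt i (i, j) j (u : FieldPair Ω) w v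
      - 1 / 2 * coordInt j (i, i) j (w : FieldPair Ω) u v) := by
  unfold b
  rw [convection_eq_sum hK, convection_eq_sum hK, Finset.mul_sum, Finset.mul_sum,
    ← Finset.sum_sub_distrib]
  refine Finset.sum_congr rfl fun j _ => ?_
  rw [Finset.mul_sum, Finset.mul_sum, ← Finset.sum_sub_distrib]
  refine Finset.sum_congr rfl fun i _ => ?_
  have := coordInt_by_parts hK u.2.2 v.2.2 w.2.2 i j
  linarith

/-- The bound on `b` with only half a derivative on the second argument. For a discrete second
argument, the inverse inequality turns the last factor into `h^{-1/2} ‖v‖`. -/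
theorem exists_abs_b_le (hd : d = 2 ∨ d = 3) (hΩ : Bornology.IsBounded Ω) :
    ∃ K : ℝ, 0 < K ∧ ∀ u v w : X Ω,
      |b u v w| ≤ K * ‖grad u‖ * ‖grad w‖ * √(‖grad v‖ * ‖fld v‖) := by
  obtain ⟨K, hK⟩ := exists_isSobolevConstant hd hΩ
  -- The summand `1` only makes the constant positive.
  refine ⟨1 + d * (d * (2 * (K * √K))), by positivity, fun u v w => ?_⟩
  set R : ℝ := ‖grad u‖ * ‖grad w‖ * √(‖grad v‖ * ‖fld v‖) with hR
  have hR0 : 0 ≤ R := by positivity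
  have hsqrt : √(K * ‖grad v‖ * ‖fld v‖) = √K * √(‖grad v‖ * ‖fld v‖) := by
    rw [mul_assoc, Real.sqrt_mul K.coe_nonneg]
  have hterm : ∀ i j, |-coordInt i (i, j) j (u : FieldPair Ω) w v
      - 1 / 2 * coordInt j (i, i) j (w : FieldPair Ω) u v| ≤ 2 * (K * √K) * R := by
    intro i j
    have h1 : |coordInt i (i, j) j (u : FieldPair Ω) w v| ≤ K * √K * R := by
      refine (abs_coordInt_le hK u.2.2 v.2.2 i (i, j) j).trans (le_of_eq ?_)
      change K * ‖grad u‖ * ‖grad w‖ * √(K * ‖grad v‖ * ‖fld v‖) = _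
      rw [hsqrt]
      ring
    have h2 : |coordInt j (i, i) j (w : FieldPair Ω) u v| ≤ K * √K * R := by
      refine (abs_coordInt_le hK w.2.2 v.2.2 j (i, i) j).trans (le_of_eq ?_)
      change K * ‖grad w‖ * ‖grad u‖ * √(K * ‖grad v‖ * ‖fld v‖) = _
      rw [hsqrt]
      ring
    rw [abs_le] at h1 h2 ⊢
    constructor <;> linarith
  rw [b_eq_sum hK]
  calc _ ≤ ∑ _j : Fin d, ∑ _i : Fin d, 2 * (K * √K) * R :=
        (Finset.abs_sum_le_sum_abs _ _).trans (Finset.sum_le_sum fun j _ =>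
          (Finset.abs_sum_le_sum_abs _ _).trans (Finset.sum_le_sum fun i _ => hterm i j))
    _ = d * (d * (2 * (K * √K))) * R := by
        simp
        ring
    _ ≤ (1 + d * (d * (2 * (K * √K)))) * R := by gcongr; linarith
    _ = _ := by rw [hR]; ring

/-- The supremum defining the dual norm is finite, by the Poincaré inequality, hence is a bound. -/
theorem le_dualNorm_mul (hd : d = 2 ∨ d = 3) (hΩ : Bornology.IsBounded Ω) (g : XDual Ω)
    (v : X Ω) : g v ≤ dualNorm g * ‖grad v‖ := by
  obtain ⟨P, hP⟩ := exists_norm_fst_le_norm_snd hd hΩ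
  have hP' : ∀ v : X Ω, ‖v‖ ≤ (P + 1) * ‖grad v‖ := fun v => by
    have h1 : ‖fld v‖ ≤ P * ‖grad v‖ := hP v v.2.2
    have h2 : ‖(v : FieldPair Ω)‖ ≤ ‖fld v‖ + ‖grad v‖ := by
      rw [WithLp.prod_norm_eq_of_L2]
      refine Real.sqrt_le_iff.mpr ⟨by positivity, ?_⟩
      change ‖fld v‖ ^ 2 + ‖grad v‖ ^ 2 ≤ _
      nlinarith [norm_nonneg (fld v), norm_nonneg (grad v)]
    rw [Submodule.norm_coe] at h2
    linarith
  by_cases hv : v = 0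
  · rw [hv, map_zero]
    simp [grad]
  have hpos : ∀ v : X Ω, v ≠ 0 → 0 < ‖grad v‖ := fun v hv => by
    refine (norm_nonneg _).lt_of_ne fun h => hv (norm_le_zero_iff.mp ?_)
    simpa [← h] using hP' v
  rw [← div_le_iff₀ (hpos v hv)]
  refine le_csSup ⟨‖g‖ * (P + 1), ?_⟩ ⟨v, hv, rfl⟩
  rintro r ⟨w, hw, rfl⟩
  rw [div_le_iff₀ (hpos w hw), mul_assoc]
  exact ((le_abs_self _).trans (g.le_opNorm w)).trans
    (mul_le_mul_of_nonneg_left (hP' w) g.opNorm_nonneg)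

/-! ### Time steps and coefficients of the DLN method -/

variable {N : ℕ} {T : ℝ}

theorem TimeGrid.k_pos (τ : TimeGrid N T) {n : ℕ} (hn : n < N) : 0 < τ.k n :=
  sub_pos.mpr (τ.t_lt n hn)

theorem TimeGrid.ε_lt_one (τ : TimeGrid N T) {n : ℕ} (hn : n < N) : τ.ε n < 1 := by
  have h1 := τ.k_pos hn
  have h0 := τ.k_pos (n := n - 1) (by omega)
  unfold TimeGrid.ε
  rw [div_lt_one (by positivity)]
  linarith

theorem TimeGrid.neg_one_lt_ε (τ : TimeGrid N T) {n : ℕ} (hn : n < N) : -1 < τ.ε n := by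
  have h1 := τ.k_pos hn
  have h0 := τ.k_pos (n := n - 1) (by omega)
  unfold TimeGrid.ε
  rw [lt_div_iff₀ (by positivity)]
  linarith

theorem TimeGrid.khat_pos (τ : TimeGrid N T) {θ : ℝ} (h0 : 0 < θ) (h1 : θ < 1) {n : ℕ}
    (hn : n < N) : 0 < τ.khat θ n := by
  have hk := τ.k_pos hn
  have hk' := τ.k_pos (n := n - 1) (by omega)
  unfold TimeGrid.khat α₂ α₀
  nlinarith

theorem TimeGrid.khat_le (τ : TimeGrid N T) {θ : ℝ} (h0 : 0 < θ) (h1 : θ < 1) {n : ℕ}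
    (hn : n < N) : τ.khat θ n ≤ τ.k n + τ.k (n - 1) := by
  have hk := τ.k_pos hn
  have hk' := τ.k_pos (n := n - 1) (by omega)
  unfold TimeGrid.khat α₂ α₀
  nlinarith

theorem one_sub_le_one_add_mul {θ ε : ℝ} (h0 : 0 < θ) (hε : -1 < ε) : 1 - θ ≤ 1 + ε * θ := by
  nlinarith

theorem β₂_nonneg {θ ε : ℝ} (h0 : 0 < θ) (h1 : θ < 1) : 0 ≤ β₂ θ ε := by
  have : 0 ≤ 1 - θ ^ 2 := by nlinarith
  unfold β₂
  positivity

theorem β₂_le {θ ε : ℝ} (h0 : 0 < θ) (h1 : θ < 1) (hε : -1 < ε) (hε' : ε < 1) :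
    β₂ θ ε ≤ 1 / (1 - θ) ^ 2 := by
  have hθ : 0 < 1 - θ := by linarith
  have h2 : (1 - θ ^ 2) / (1 + ε * θ) ^ 2 ≤ 1 / (1 - θ) ^ 2 := by
    have := one_sub_le_one_add_mul h0 hε
    gcongr
    nlinarith
  have hq : 0 ≤ (1 - θ ^ 2) / (1 + ε * θ) ^ 2 := div_nonneg (by nlinarith) (sq_nonneg _)
  have h3 : ε ^ 2 * (θ * (1 - θ ^ 2) / (1 + ε * θ) ^ 2) ≤ (1 - θ ^ 2) / (1 + ε * θ) ^ 2 := by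
    rw [mul_div_assoc, ← mul_assoc]
    refine mul_le_of_le_one_left hq ?_
    nlinarith [sq_nonneg ε]
  have h4 : 1 ≤ 1 / (1 - θ) ^ 2 := by
    rw [le_div_iff₀ (by positivity)]
    nlinarith
  unfold β₂
  linarith

/-- The `G`-stability identity of the DLN method: testing `z_{n,α}` with `z_{n,β}` produces the
increment of a positive definite quadratic form in two consecutive values, plus numerical
dissipation. -/
theorem inner_dln_combination {H : Type*} [NormedAddCommGroup H] [InnerProductSpace ℝ H]
    {θ ε : ℝ} (hne : 1 + ε * θ ≠ 0) (x y z : H) :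
    inner ℝ (α₂ θ • x + α₁ θ • y + α₀ θ • z) (β₂ θ ε • x + β₁ θ ε • y + β₀ θ ε • z)
      = ((1 + θ) / 4 * ‖x‖ ^ 2 + (1 - θ) / 4 * ‖y‖ ^ 2)
        - ((1 + θ) / 4 * ‖y‖ ^ 2 + (1 - θ) / 4 * ‖z‖ ^ 2)
        + 2 * (θ * (1 - θ ^ 2) / (4 * (1 + ε * θ) ^ 2))
          * ‖((1 - ε) / 2) • x - y + ((1 + ε) / 2) • z‖ ^ 2 := by
  simp only [← real_inner_self_eq_norm_sq, inner_add_left, inner_add_right, inner_sub_left,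
    inner_sub_right, real_inner_smul_left, real_inner_smul_right]
  rw [real_inner_comm x y, real_inner_comm x z, real_inner_comm y z]
  set q : ℝ := (1 - θ ^ 2) / (1 + ε * θ) ^ 2 with hq
  have hq' : q * (1 + ε * θ) ^ 2 = 1 - θ ^ 2 := div_mul_cancel₀ _ (pow_ne_zero 2 hne)
  have e1 : θ * (1 - θ ^ 2) / (1 + ε * θ) ^ 2 = θ * q := mul_div_assoc _ _ _
  have e2 : θ * (1 - θ ^ 2) / (4 * (1 + ε * θ) ^ 2) = θ * q / 4 := by
    rw [← e1, div_div, mul_comm 4]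
  unfold α₂ α₁ α₀ β₂ β₁ β₀
  rw [e2, e1, ← hq]
  -- After clearing constants, both sides differ by a combination of inner products times
  -- `q (1 + ε θ)² - (1 - θ²)`.
  linear_combination (1 / 8 * inner ℝ x x - 1 / 4 * inner ℝ x y + 1 / 4 * inner ℝ y z
    - 1 / 8 * inner ℝ z z) * hq'

/-- The extrapolation `z_{n,∗}` differs from `z_{n,β}` by a multiple of the second difference. -/
theorem starComb_eq {V : Type} [AddCommGroup V] [Module ℝ V] (τ : TimeGrid N T) (θ : ℝ)
    (z : ℕ → V) {n : ℕ} (hn : n < N) :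
    starComb τ θ z n
      = betaComb τ θ z n - (2 * β₂ θ (τ.ε n) / (1 - τ.ε n)) • secondDiff τ z n := by
  have hk := τ.k_pos hn
  have hk' := τ.k_pos (n := n - 1) (by omega)
  have hε : 1 - τ.ε n = 2 * τ.k (n - 1) / (τ.k n + τ.k (n - 1)) := by
    unfold TimeGrid.ε
    field_simp
    ring
  have hε' : 1 + τ.ε n = 2 * τ.k n / (τ.k n + τ.k (n - 1)) := by
    unfold TimeGrid.ε
    field_simp
    ring
  unfold starComb betaComb secondDiff
  rw [hε, hε']
  match_scalars <;> field_simp <;> ring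

theorem fld_alphaComb (θ : ℝ) (z : ℕ → X Ω) (n : ℕ) :
    fld (alphaComb θ z n) = alphaComb θ (fun m => fld (z m)) n := rfl

theorem fld_betaComb (τ : TimeGrid N T) (θ : ℝ) (z : ℕ → X Ω) (n : ℕ) :
    fld (betaComb τ θ z n) = betaComb τ θ (fun m => fld (z m)) n := rfl

theorem betaComb_mem {V : Type} [AddCommGroup V] [Module ℝ V] {W : Submodule ℝ V}
    (τ : TimeGrid N T) (θ : ℝ) {z : ℕ → V} (hz : ∀ n ≤ N, z n ∈ W) {n : ℕ} (hn : n < N) :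
    betaComb τ θ z n ∈ W :=
  add_mem (add_mem (W.smul_mem _ (hz _ hn)) (W.smul_mem _ (hz _ hn.le)))
    (W.smul_mem _ (hz _ (by omega)))

theorem secondDiff_mem {V : Type} [AddCommGroup V] [Module ℝ V] {W : Submodule ℝ V}
    (τ : TimeGrid N T) {z : ℕ → V} (hz : ∀ n ≤ N, z n ∈ W) {n : ℕ} (hn : n < N) :
    secondDiff τ z n ∈ W :=
  add_mem (sub_mem (W.smul_mem _ (hz _ hn)) (hz _ hn.le)) (W.smul_mem _ (hz _ (by omega)))

/-! ### The energy estimate for one time step -/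

/-- Young's inequality for one time step. Of the viscous term `κ ν g²`, a quarter absorbs the
forcing and a half the fluctuation term; half of the numerical dissipation `2 D f²` absorbs the rest
of the fluctuation term. -/
theorem absorb_forcing_and_fluctuation {ν κ Δ D f g φ c : ℝ} (hν : 0 < ν) (hκ : 0 < κ)
    (h : Δ + 2 * D * f ^ 2 + κ * (ν * g ^ 2) ≤ κ * (φ * g) + κ * (c * g * f))
    (hc : κ / (2 * ν) * c ^ 2 ≤ D) :
    Δ + D * f ^ 2 + ν * κ / 4 * g ^ 2 ≤ 1 / ν * (κ * φ ^ 2) := by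
  have h1 : φ * g ≤ ν / 4 * g ^ 2 + 1 / ν * φ ^ 2 := by
    have : ν / 4 * g ^ 2 + 1 / ν * φ ^ 2 - φ * g = (ν * g / 2 - φ) ^ 2 / ν := by
      field_simp
      ring
    linarith [div_nonneg (sq_nonneg (ν * g / 2 - φ)) hν.le]
  have h2 : c * g * f ≤ ν / 2 * g ^ 2 + 1 / (2 * ν) * c ^ 2 * f ^ 2 := by
    have : ν / 2 * g ^ 2 + 1 / (2 * ν) * c ^ 2 * f ^ 2 - c * g * f
        = (ν * g - c * f) ^ 2 / (2 * ν) := by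
      field_simp
      ring
    linarith [div_nonneg (sq_nonneg (ν * g - c * f)) (by positivity : 0 ≤ 2 * ν)]
  have h3 : κ / (2 * ν) * c ^ 2 * f ^ 2 ≤ D * f ^ 2 := by gcongr
  have h1' := mul_le_mul_of_nonneg_left h1 hκ.le
  have h2' := mul_le_mul_of_nonneg_left h2 hκ.le
  have e : κ * (1 / (2 * ν) * c ^ 2 * f ^ 2) = κ / (2 * ν) * c ^ 2 * f ^ 2 := by ring
  nlinarith

/-- The CFL-like condition, with `8 B² K² Cinv / (θ (1 - θ²))` as its constant, is what makes the
fluctuation term absorbable by half of the numerical dissipation. Here `B` bounds `β₂`, and `K` is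
the constant of the trilinear estimate. -/
theorem fluctuation_coefficient_le {K Cinv B h ν κ β ε θ g : ℝ} (hK : 0 < K) (hC : 0 < Cinv)
    (hB : 0 < B) (hh : 0 < h) (hν : 0 < ν) (hκ : 0 < κ) (hβ0 : 0 ≤ β) (hβ : β ≤ B) (hε : ε < 1)
    (h0 : 0 < θ) (h1 : θ < 1) (hεθ : 0 < 1 + ε * θ)
    (hcfl : 0 ≤ 1 - 8 * B ^ 2 * K ^ 2 * Cinv / (θ * (1 - θ ^ 2)) * ((1 + ε * θ) / (1 - ε)) ^ 2
      * (κ / (h * ν)) * g ^ 2) :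
    κ / (2 * ν) * (2 * β / (1 - ε) * K * g * √(Cinv / h)) ^ 2
      ≤ θ * (1 - θ ^ 2) / (4 * (1 + ε * θ) ^ 2) := by
  have hε1 : 0 < 1 - ε := by linarith
  have hθ : 0 < 1 - θ ^ 2 := by nlinarith
  have hs : √(Cinv / h) ^ 2 = Cinv / h := Real.sq_sqrt (by positivity)
  have hββ : β ^ 2 ≤ B ^ 2 := by gcongr
  calc κ / (2 * ν) * (2 * β / (1 - ε) * K * g * √(Cinv / h)) ^ 2
      = κ / (2 * ν) * (2 / (1 - ε) * K * g) ^ 2 * (Cinv / h) * β ^ 2 := by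
        rw [mul_pow _ √(Cinv / h), hs]; ring
    _ ≤ κ / (2 * ν) * (2 / (1 - ε) * K * g) ^ 2 * (Cinv / h) * B ^ 2 := by gcongr
    _ = θ * (1 - θ ^ 2) / (4 * (1 + ε * θ) ^ 2) *
          (8 * B ^ 2 * K ^ 2 * Cinv / (θ * (1 - θ ^ 2)) * ((1 + ε * θ) / (1 - ε)) ^ 2
            * (κ / (h * ν)) * g ^ 2) := by
        field_simp
        ring
    _ ≤ _ := mul_le_of_le_one_right (by positivity) (by linarith)

/-- The energy estimate for one time step, from testing the momentum equation with
`u_{n,β}`. -/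
theorem energy_step (hd : d = 2 ∨ d = 3) (hΩ : Bornology.IsBounded Ω) {K Cinv θ h ν : ℝ}
    (hK : 0 < K)
    (hb : ∀ u v w : X Ω, |b u v w| ≤ K * ‖grad u‖ * ‖grad w‖ * √(‖grad v‖ * ‖fld v‖))
    (hC : 0 < Cinv) (h0 : 0 < θ) (h1 : θ < 1) (hh : 0 < h) (hν : 0 < ν)
    {Xh : Submodule ℝ (X Ω)} {Qh : Submodule ℝ (Q Ω)} (hinv : InverseInequality Xh Cinv h)
    {τ : TimeGrid N T} {J : ℕ} {f : Fin J → ℝ → XDual Ω} {u : Fin J → ℕ → X Ω}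
    {p : Fin J → ℕ → Q Ω} (hsol : IsDLNEnsembleSolution Xh Qh θ ν τ f u p)
    (hcfl : CFLCondition (8 * (1 / (1 - θ) ^ 2) ^ 2 * K ^ 2 * Cinv / (θ * (1 - θ ^ 2))) h θ ν τ u)
    (j : Fin J) {n : ℕ} (hn1 : 1 ≤ n) (hn : n < N) :
    ((1 + θ) / 4 * ‖fld (u j (n + 1))‖ ^ 2 + (1 - θ) / 4 * ‖fld (u j n)‖ ^ 2)
        - ((1 + θ) / 4 * ‖fld (u j n)‖ ^ 2 + (1 - θ) / 4 * ‖fld (u j (n - 1))‖ ^ 2)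
        + θ * (1 - θ ^ 2) / (4 * (1 + τ.ε n * θ) ^ 2) * ‖fld (secondDiff τ (u j) n)‖ ^ 2
        + ν * τ.khat θ n / 4 * ‖grad (betaComb τ θ (u j) n)‖ ^ 2
      ≤ 1 / ν * ((τ.k n + τ.k (n - 1)) * dualNorm (f j (betaComb τ θ τ.t n)) ^ 2) := by
  obtain ⟨K₆, hK₆⟩ := exists_isSobolevConstant hd hΩ
  have hκ := τ.khat_pos h0 h1 hn
  have hε := τ.ε_lt_one hn
  have hε' := τ.neg_one_lt_ε hn
  have hθ : 0 < 1 - θ := by linarith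
  have hεθ : 0 < 1 + τ.ε n * θ := hθ.trans_le (one_sub_le_one_add_mul h0 hε')
  set w := betaComb τ θ (u j) n with hw
  set U := secondDiff τ (u j) n with hU
  set u' := starComb τ θ (u j) n - starComb τ θ (ensembleAvg u) n with hu'
  set β := β₂ θ (τ.ε n) with hβ
  have hwX : w ∈ Xh := betaComb_mem τ θ (hsol.velocity_mem j) hn
  have hUX : U ∈ Xh := secondDiff_mem τ (hsol.velocity_mem j) hn
  have hmom := hsol.momentum j n hn1 (by omega) w hwX
  have hpress : pressureDiv (betaComb τ θ (p j) n) w = 0 :=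
    hsol.incompressible j n hn1 (by omega) _ (betaComb_mem τ θ (hsol.pressure_mem j) hn)
  have hα : inner ℝ (fld ((τ.khat θ n)⁻¹ • alphaComb θ (u j) n)) (fld w)
      = (τ.khat θ n)⁻¹ * inner ℝ (fld (alphaComb θ (u j) n)) (fld w) :=
    real_inner_smul_left (fld (alphaComb θ (u j) n)) (fld w) _
  -- The skew-symmetry of `b` cancels the part `u_{n,β}` of the extrapolation `u_{n,∗}`.
  have hstar : b u' (starComb τ θ (u j) n) w = -(2 * β / (1 - τ.ε n) * b u' U w) := by
    rw [starComb_eq τ θ (u j) hn, b_sub_smul_mid hK₆, b_self_right, zero_sub]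
  rw [← hw, ← hu', hpress, b_self_right, hα, hstar, real_inner_self_eq_norm_sq,
    fld_alphaComb, hw, fld_betaComb] at hmom
  have hid : inner ℝ (alphaComb θ (fun m => fld (u j m)) n) (betaComb τ θ (fun m => fld (u j m)) n)
      = _ := inner_dln_combination hεθ.ne' _ _ _
  rw [hid, ← hw] at hmom
  have hgU : √(‖grad U‖ * ‖fld U‖) ≤ √(Cinv / h) * ‖fld U‖ := by
    rw [Real.sqrt_le_left (by positivity), mul_pow, Real.sq_sqrt (by positivity)]
    have := mul_le_mul_of_nonneg_right (hinv U hUX) (norm_nonneg (fld U))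
    rw [div_eq_mul_inv]
    linarith
  have hbU : b u' U w ≤ K * ‖grad u'‖ * √(Cinv / h) * ‖grad w‖ * ‖fld U‖ := by
    refine (le_abs_self _).trans ((hb u' U w).trans ?_)
    calc _ ≤ K * ‖grad u'‖ * ‖grad w‖ * (√(Cinv / h) * ‖fld U‖) := by gcongr
      _ = _ := by ring
  have hβ0 : 0 ≤ β := β₂_nonneg h0 h1
  have hcoef : 0 ≤ 2 * β / (1 - τ.ε n) := div_nonneg (by positivity) (by linarith)
  have hF := le_dualNorm_mul hd hΩ (f j (betaComb τ θ τ.t n)) w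
  have hc := fluctuation_coefficient_le (g := ‖grad u'‖) hK hC (by positivity) hh hν hκ hβ0
    (β₂_le h0 h1 hε' hε) hε h0 h1 hεθ (hcfl j n hn1 (by omega))
  have hbU' := mul_le_mul_of_nonneg_left hbU hcoef
  refine (absorb_forcing_and_fluctuation (f := ‖fld U‖) (g := ‖grad w‖)
    (φ := dualNorm (f j (betaComb τ θ τ.t n))) hν hκ ?_ hc).trans ?_
  · -- The tested equation is multiplied by `k̂_n` and solved for the energy increment.
    have hclear : ∀ {A F B G : ℝ}, (τ.khat θ n)⁻¹ * A + 0 - 0 + G = F - -B →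
        A + τ.khat θ n * G = τ.khat θ n * (F + B) := fun {A F B G} h => by
      have hA : A = τ.khat θ n * ((τ.khat θ n)⁻¹ * A) := (mul_inv_cancel_left₀ hκ.ne' A).symm
      have : (τ.khat θ n)⁻¹ * A = F + B - G := by linarith
      rw [this] at hA
      rw [hA]
      ring
    refine (le_of_eq ?_).trans ((hclear hmom).le.trans
      ((mul_le_mul_of_nonneg_left (add_le_add hF hbU') hκ.le).trans (le_of_eq ?_)))
    · rfl
    · ring
  · have := τ.khat_le h0 h1 hn
    gcongr

end DLNEnsemble

theorem mainTheorem2 :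
    ∃ C : ℝ, 0 < C ∧
    ∀ (d : ℕ) (_ : d = 2 ∨ d = 3) (Ω : Set (DLNEnsemble.E d))
      (_ : IsOpen Ω) (_ : Bornology.IsBounded Ω)
      (Cinv : ℝ) (_ : 0 < Cinv) (θ : ℝ) (_ : 0 < θ) (_ : θ < 1),
    ∃ C₀ : ℝ, 0 < C₀ ∧
    ∀ (h : ℝ) (_ : 0 < h) (_ : h ≤ 1)
      (Xh : Submodule ℝ (DLNEnsemble.X Ω)) (Qh : Submodule ℝ (DLNEnsemble.Q Ω))
      (_ : DLNEnsemble.InverseInequality Xh Cinv h)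
      (ν : ℝ) (_ : 0 < ν) (N : ℕ) (T : ℝ) (τ : DLNEnsemble.TimeGrid N T)
      (J : ℕ) (f : Fin J → ℝ → DLNEnsemble.XDual Ω)
      (u : Fin J → ℕ → DLNEnsemble.X Ω) (p : Fin J → ℕ → DLNEnsemble.Q Ω)
      (_ : DLNEnsemble.IsDLNEnsembleSolution Xh Qh θ ν τ f u p)
      (_ : DLNEnsemble.CFLCondition C₀ h θ ν τ u)
      (j : Fin J) (M : ℕ) (_ : 2 ≤ M) (_ : M ≤ N),
      (1 + θ) / 4 * ‖DLNEnsemble.fld (u j M)‖ ^ 2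
        + (1 - θ) / 4 * ‖DLNEnsemble.fld (u j (M - 1))‖ ^ 2
        + ∑ n ∈ Finset.Icc 1 (M - 1), θ * (1 - θ ^ 2) / (4 * (1 + τ.ε n * θ) ^ 2)
            * ‖DLNEnsemble.fld (DLNEnsemble.secondDiff τ (u j) n)‖ ^ 2
        + ∑ n ∈ Finset.Icc 1 (M - 1), ν * τ.khat θ n / 4
            * ‖DLNEnsemble.grad (DLNEnsemble.betaComb τ θ (u j) n)‖ ^ 2
      ≤ C / ν * DLNEnsemble.discreteDualNorm τ θ (f j) ^ 2
        + (1 + θ) / 4 * ‖DLNEnsemble.fld (u j 1)‖ ^ 2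
        + (1 - θ) / 4 * ‖DLNEnsemble.fld (u j 0)‖ ^ 2 := by
  refine ⟨1, one_pos, fun d hd Ω _ hΩ Cinv hC θ h0 h1 => ?_⟩
  obtain ⟨K, hK, hb⟩ := DLNEnsemble.exists_abs_b_le hd hΩ
  have hθ : 0 < 1 - θ := by linarith
  have hθ2 : 0 < 1 - θ ^ 2 := by nlinarith
  refine ⟨8 * (1 / (1 - θ) ^ 2) ^ 2 * K ^ 2 * Cinv / (θ * (1 - θ ^ 2)), by positivity, ?_⟩
  intro h hh _ Xh Qh hinv ν hν N T τ J f u p hsol hcfl j M hM hMN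
  -- The forcing terms of the full time grid dominate those of the first `M - 1` steps.
  set D : ℕ → ℝ := fun n => (τ.k n + τ.k (n - 1))
    * DLNEnsemble.dualNorm (f j (DLNEnsemble.betaComb τ θ τ.t n)) ^ 2 with hD
  have hD0 : ∀ n ∈ Finset.Icc 1 (N - 1), 0 ≤ D n := fun n hn => by
    rw [Finset.mem_Icc] at hn
    have hk := τ.k_pos (n := n) (by omega)
    have hk' := τ.k_pos (n := n - 1) (by omega)
    positivity
  have hnorm : ∑ n ∈ Finset.Icc 1 (M - 1), D n ≤ DLNEnsemble.discreteDualNorm τ θ (f j) ^ 2 := by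
    unfold DLNEnsemble.discreteDualNorm
    rw [Real.sq_sqrt (Finset.sum_nonneg hD0)]
    exact Finset.sum_le_sum_of_subset_of_nonneg (Finset.Icc_subset_Icc le_rfl (by omega))
      fun n hn _ => hD0 n hn
  set G : ℕ → ℝ := fun n => (1 + θ) / 4 * ‖DLNEnsemble.fld (u j n)‖ ^ 2
    + (1 - θ) / 4 * ‖DLNEnsemble.fld (u j (n - 1))‖ ^ 2 with hG
  have htel : ∑ n ∈ Finset.Icc 1 (M - 1), (G (n + 1) - G n) = G M - G 1 := by
    rw [show Finset.Icc 1 (M - 1) = Finset.Ico 1 M by ext n; simp; omega]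
    exact Finset.sum_Ico_sub G (by omega)
  have hsum := Finset.sum_le_sum fun n (hn : n ∈ Finset.Icc 1 (M - 1)) =>
    DLNEnsemble.energy_step hd hΩ hK hb hC h0 h1 hh hν hinv hsol hcfl j
      (Finset.mem_Icc.mp hn).1 (show n < N by have := (Finset.mem_Icc.mp hn).2; omega)
  rw [Finset.sum_add_distrib, Finset.sum_add_distrib, ← Finset.mul_sum] at hsum
  have htel' : ∑ n ∈ Finset.Icc 1 (M - 1),
      (((1 + θ) / 4 * ‖DLNEnsemble.fld (u j (n + 1))‖ ^ 2
          + (1 - θ) / 4 * ‖DLNEnsemble.fld (u j n)‖ ^ 2)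
        - ((1 + θ) / 4 * ‖DLNEnsemble.fld (u j n)‖ ^ 2
          + (1 - θ) / 4 * ‖DLNEnsemble.fld (u j (n - 1))‖ ^ 2)) = G M - G 1 := htel
  rw [htel'] at hsum
  have hforce := mul_le_mul_of_nonneg_left hnorm (one_div_pos.mpr hν).le
  have hG1 : G 1 = (1 + θ) / 4 * ‖DLNEnsemble.fld (u j 1)‖ ^ 2
    + (1 - θ) / 4 * ‖DLNEnsemble.fld (u j 0)‖ ^ 2 := rfl
  rw [hG1] at hsum
  simp only [hG, hD] at hsum hforce
  linarith
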